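/- Let $R$ be a commutative noetherian ring, $I,J$ ideals of $R$, and $M$ a finitely generated $R$-module with $IM\neq M$. Notation. Let $\tilde W(I,J)$ be the set of ideals $\mathfrak a$ of $R$ with $I^n\subseteq \mathfrak a+J$ for some $n\ge 1$. For an $R$-module $N$ put $\Gamma_I(N)=\{x\in N : I^n x=0 \text{ for } n\gg 0\}$ and $\Gamma_{I,J}(N)=\{x\in N : I^n x\subseteq Jx \text{ for } n\gg 0\}$, and let $H^i_I$ and $H^i_{I,J}$ be the $i$-th right derived functors of $\Gamma_I$ and $\Gamma_{I,J}$. For an ideal $\mathfrak a$, $\operatorname{depth}(\mathfrak a,M)$ is the supremum of the lengths of the $M$-regular sequences in $\mathfrak a$ if $\mathfrak aM\ne M$, and $\infty$ if $\mathfrak aM=M$; and $\operatorname{depth}(I,J,M)=\inf\{\operatorname{depth}(\mathfrak a,M) : \mathfrak a\in\tilde W(I,J)\}$. A sequence $x_1,\dots,x_t$ in $R$ is a poor regular $M$-sequence if each $x_i$ is a nonzerodivisor on $M/(x_1,\dots,x_{i-1})M$ (with $M/(x_1,\dots,x_t)M=0$ allowed). Theorem 3.9. The number $t:=\operatorname{depth}(I,J,M)$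 is finite, and the following hold. (i) $H^t_I(M)\neq 0$ if and only if $t=\operatorname{depth}(I,M)$. (ii) If $H^t_I(M)\neq0$, then $\operatorname{depth}(I,M)\le\operatorname{depth}(\mathfrak a,M)$ for all $\mathfrak a\in\tilde W(I,J)$. (iii) $\operatorname{depth}(\mathfrak p,M)=t$ for all $\mathfrak p\in\operatorname{Ass}(H^t_{I,J}(M))$. (iv) $\operatorname{depth}(\mathfrak p,M)\le\operatorname{depth}(\mathfrak a,M)$ for all $\mathfrak p\in\operatorname{Ass}(H^t_{I,J}(M))$ and all $\mathfrak a\in\tilde W(I,J)$. (v) There is a poor regular $M$-sequence of length $t$ in $I$, and for every such sequence $x_1,\dots,x_t$ there are isomorphisms of $R$-modules $$\operatorname{Hom}_R(R/I,H^t_{I,J}(M))\cong\operatorname{Ext}^t_R(R/I,M)\cong\operatorname{Hom}_R(R/I,H^t_I(M))\cong\operatorname{Hom}_R(R/I,M/(x_1,\dots,x_t)M).$$ -/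

import Mathlib

universe u

namespace PairDepth

open CategoryTheory

/-- The `I`-torsion submodule `Γ_I(N) = {x ∈ N | I ^ n x = 0 for some n}`. -/
def torsion {R : Type u} [CommRing R] (I : Ideal R)
    (N : Type u) [AddCommGroup N] [Module R N] : Submodule R N where
  carrier := {x | ∃ n : ℕ, ∀ a ∈ I ^ n, a • x = 0}
  zero_mem' := ⟨0, fun a _ => smul_zero a⟩
  add_mem' := by
    rintro x y ⟨n, hn⟩ ⟨m, hm⟩
    refine ⟨n + m, fun a ha => ?_⟩
    rw [smul_add, hn a (Ideal.pow_le_pow_right (Nat.le_add_right n m) ha),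
      hm a (Ideal.pow_le_pow_right (Nat.le_add_left m n) ha), add_zero]
  smul_mem' := by
    rintro r x ⟨n, hn⟩
    exact ⟨n, fun a ha => by rw [smul_comm, hn a ha, smul_zero]⟩

/-- The `(I, J)`-torsion submodule
`Γ_{I,J}(N) = {x ∈ N | I ^ n x ⊆ J x for some n}`. As `I ^ n x ⊆ J x` implies
`I ^ m x ⊆ J x` for all `m ≥ n`, "for some `n`" is the same as "for all large `n`". -/
def pairTorsion {R : Type u} [CommRing R] (I J : Ideal R)
    (N : Type u) [AddCommGroup N] [Module R N] : Submodule R N where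
  carrier := {x | ∃ n : ℕ, ∀ a ∈ I ^ n, ∃ b ∈ J, a • x = b • x}
  zero_mem' := ⟨0, fun a _ => ⟨0, J.zero_mem, by simp⟩⟩
  add_mem' := by
    rintro x y ⟨n, hn⟩ ⟨m, hm⟩
    refine ⟨n + m, fun a ha => ?_⟩
    rw [pow_add] at ha
    induction ha using Submodule.mul_induction_on' with
    | mem_mul_mem p hp q hq =>
      obtain ⟨b, hb, hpb⟩ := hn p hp
      obtain ⟨c, hc, hqc⟩ := hm q hq
      refine ⟨p * c + b * q - b * c,
        J.sub_mem (J.add_mem (J.mul_mem_left p hc) (J.mul_mem_right q hb))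
          (J.mul_mem_left b hc), ?_⟩
      have h1 : (p - b) • x = 0 := by rw [sub_smul, hpb, sub_self]
      have h2 : (q - c) • y = 0 := by rw [sub_smul, hqc, sub_self]
      have h3 : ((p - b) * (q - c)) • (x + y) = 0 := by
        rw [smul_add, mul_smul _ _ y, h2, mul_comm, mul_smul, h1]
        simp
      rw [← sub_eq_zero, ← sub_smul, ← h3]
      congr 1
      ring
    | add p _ q _ hp hq =>
      obtain ⟨b, hb, hpb⟩ := hp
      obtain ⟨c, hc, hqc⟩ := hq
      exact ⟨b + c, J.add_mem hb hc, by rw [add_smul, add_smul, hpb, hqc]⟩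
  smul_mem' := by
    rintro r x ⟨n, hn⟩
    refine ⟨n, fun a ha => ?_⟩
    obtain ⟨b, hb, hab⟩ := hn a ha
    exact ⟨b, hb, by rw [smul_comm, hab, smul_comm]⟩

theorem map_mem_torsion {R : Type u} [CommRing R] (I : Ideal R)
    {N P : Type u} [AddCommGroup N] [Module R N] [AddCommGroup P] [Module R P]
    (f : N →ₗ[R] P) (x : N) (hx : x ∈ torsion I N) : f x ∈ torsion I P := by
  obtain ⟨n, hn⟩ := hx
  exact ⟨n, fun a ha => by rw [← map_smul, hn a ha, map_zero]⟩

theorem map_mem_pairTorsion {R : Type u} [CommRing R] (I J : Ideal R)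
    {N P : Type u} [AddCommGroup N] [Module R N] [AddCommGroup P] [Module R P]
    (f : N →ₗ[R] P) (x : N) (hx : x ∈ pairTorsion I J N) : f x ∈ pairTorsion I J P := by
  obtain ⟨n, hn⟩ := hx
  refine ⟨n, fun a ha => ?_⟩
  obtain ⟨b, hb, hab⟩ := hn a ha
  exact ⟨b, hb, by rw [← map_smul, hab, map_smul]⟩

/-- The functor `Γ_I` on `R`-modules; it restricts homomorphisms. -/
def torsionFunctor {R : Type u} [CommRing R] (I : Ideal R) :
    ModuleCat.{u} R ⥤ ModuleCat.{u} R where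
  obj N := ModuleCat.of R (torsion I N)
  map f := ModuleCat.ofHom (f.hom.restrict (map_mem_torsion I f.hom))

/-- The functor `Γ_{I,J}` on `R`-modules; it restricts homomorphisms. -/
def pairTorsionFunctor {R : Type u} [CommRing R] (I J : Ideal R) :
    ModuleCat.{u} R ⥤ ModuleCat.{u} R where
  obj N := ModuleCat.of R (pairTorsion I J N)
  map f := ModuleCat.ofHom (f.hom.restrict (map_mem_pairTorsion I J f.hom))

instance torsionFunctor_additive {R : Type u} [CommRing R] (I : Ideal R) :
    (torsionFunctor I).Additive where
  map_add := rfl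

instance pairTorsionFunctor_additive {R : Type u} [CommRing R] (I J : Ideal R) :
    (pairTorsionFunctor I J).Additive where
  map_add := rfl

/-- The local cohomology module `H^i_I(N)`, the `i`-th right derived functor of `Γ_I`. -/
noncomputable def cohomology {R : Type u} [CommRing R] (I : Ideal R) (i : ℕ)
    (N : Type u) [AddCommGroup N] [Module R N] : ModuleCat.{u} R :=
  ((torsionFunctor I).rightDerived i).obj (ModuleCat.of R N)

/-- The local cohomology module `H^i_{I,J}(N)` with respect to the pair `(I, J)`, the `i`-th
right derived functor of `Γ_{I,J}`. -/
noncomputable def pairCohomology {R : Type u} [CommRing R] (I J : Ideal R) (i : ℕ)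
    (N : Type u) [AddCommGroup N] [Module R N] : ModuleCat.{u} R :=
  ((pairTorsionFunctor I J).rightDerived i).obj (ModuleCat.of R N)

/-- The set `W̃(I, J)` of the ideals `𝔞` with `I ^ n ⊆ 𝔞 + J` for some `n ≥ 1`. -/
def tildeW {R : Type u} [CommRing R] (I J : Ideal R) : Set (Ideal R) :=
  {𝔞 | ∃ n : ℕ, 1 ≤ n ∧ I ^ n ≤ 𝔞 ⊔ J}

open Classical in
/-- The depth of the ideal `𝔞` on a finite module `N`: the supremum of the lengths of the
`N`-regular sequences in `𝔞` if `𝔞 N ≠ N`, and `∞` if `𝔞 N = N`. -/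
noncomputable def depth {R : Type u} [CommRing R] (𝔞 : Ideal R)
    (N : Type u) [AddCommGroup N] [Module R N] : ℕ∞ :=
  if 𝔞 • (⊤ : Submodule R N) = ⊤ then ⊤
  else ⨆ xs ∈ {xs : List R | (∀ x ∈ xs, x ∈ 𝔞) ∧ RingTheory.Sequence.IsRegular N xs},
    (xs.length : ℕ∞)

/-- The depth of the pair `(I, J)` on a finite module `N`: the infimum of the depths of the
ideals in `W̃(I, J)` on `N`. -/
noncomputable def pairDepth {R : Type u} [CommRing R] (I J : Ideal R)
    (N : Type u) [AddCommGroup N] [Module R N] : ℕ∞ :=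
  ⨅ 𝔞 ∈ tildeW I J, depth 𝔞 N

end PairDepth

-- Both `Γ_I` and `Γ_{I,J}` pick out the elements whose annihilator lies in an up-closed set `W` of
-- ideals: `tildeW I ⊥` and `tildeW I J`, the first contained in the second. For such a functor `F`,
-- suppose `Ext^i(R/𝔞, N) = 0` for all `i < t` and `𝔞 ∈ W`. Then `Hom(R/𝔞, R^t F N) ≅ Ext^t(R/𝔞, N)`
-- for `𝔞 ∈ W`, and every element of `R^t F N` has its annihilator in `W`
-- (`IsTorsionFunctor.rightDerived_spec`). For `t > 0`, `N` has no `W`-torsion, so neither has an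
-- essential injective extension `E`; hence `F E = 0`, and passing to `E/N` lowers the degree of
-- both `R F` and `Ext`.
--
-- Depth enters through Rees' criterion: `Ext^i(R/𝔞, M) = 0` for `i < depth 𝔞 M`, with nonvanishing
-- at the depth when `𝔞M ≠ M`. At `t = pairDepth I J M` the vanishing hypothesis therefore holds for
-- both functors. Since `H^t_I(M)` is `I`-torsion, it is nonzero exactly when `Ext^t(R/I, M)` is,
-- which is (i). An associated prime `𝔭` of `H^t_{I,J}(M)` lies in `W` and has `Ext^t(R/𝔭, M) ≠ 0`,
-- which is (iii); (ii) and (iv) follow as `t` is an infimum. The last isomorphism in (v) shifts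
-- `Ext` along the sequence.

universe v

namespace PairDepth

open CategoryTheory Abelian RingTheory.Sequence
open scoped Pointwise

/-! ### Essential injective extensions -/

section Hull

variable {R : Type u} [CommRing R]

theorem exists_maximal_essential {Q : Type v} [AddCommGroup Q] [Module R Q] (N : Submodule R Q) :
    ∃ E : Submodule R Q, N ≤ E ∧
      Maximal (fun E : Submodule R Q => ∀ x ∈ E, x ≠ 0 → ∃ r : R, r • x ≠ 0 ∧ r • x ∈ N) E := by
  refine zorn_le_nonempty₀ {E : Submodule R Q | ∀ x ∈ E, x ≠ 0 → ∃ r : R, r • x ≠ 0 ∧ r • x ∈ N}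
    (fun c hc hchain y hy => ⟨sSup c, fun x hx hx0 => ?_, fun z hz => le_sSup hz⟩) N
    (fun x hx hx0 => ⟨1, by simpa using hx0, by simpa using hx⟩)
  obtain ⟨E, hE, hxE⟩ := (Submodule.mem_sSup_of_directed ⟨y, hy⟩ hchain.directedOn).mp hx
  exact hc hE x hxE hx0

theorem exists_maximal_disjoint {Q : Type v} [AddCommGroup Q] [Module R Q] (E : Submodule R Q) :
    ∃ K : Submodule R Q, Maximal (fun K : Submodule R Q => Disjoint K E) K := by
  have h := zorn_le_nonempty₀ {K : Submodule R Q | Disjoint K E}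
    (fun c hc hchain y hy => ⟨sSup c, Submodule.disjoint_def.mpr fun x hx hxE => by
      obtain ⟨K, hK, hxK⟩ := (Submodule.mem_sSup_of_directed ⟨y, hy⟩ hchain.directedOn).mp hx
      exact Submodule.disjoint_def.mp (hc hK) x hxK hxE, fun z hz => le_sSup hz⟩) ⊥
    disjoint_bot_left
  exact h.imp fun _ hK => hK.2

/-- A maximal essential extension inside an injective module is a retract of it. -/
theorem exists_retraction_of_maximal_essential [Small.{v} R] {Q : Type v} [AddCommGroup Q]
    [Module R Q] [Module.Injective R Q] {N E : Submodule R Q}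
    (hE : Maximal (fun E : Submodule R Q => ∀ x ∈ E, x ≠ 0 → ∃ r : R, r • x ≠ 0 ∧ r • x ∈ N) E) :
    ∃ p : Q →ₗ[R] E, ∀ x : E, p x = x := by
  obtain ⟨K, hK⟩ := exists_maximal_disjoint E
  -- Maximality of `K` makes the image of `E` essential in `Q ⧸ K`.
  have key : ∀ x, x ∉ K → ∃ (r : R) (k : Q), k ∈ K ∧ k + r • x ∈ E ∧ k + r • x ≠ 0 := by
    intro x hx
    have hlt : K < K ⊔ Submodule.span R {x} :=
      lt_of_le_of_ne le_sup_left fun h =>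
        hx (h ▸ Submodule.mem_sup_right (Submodule.mem_span_singleton_self x))
    have hnd := hK.not_prop_of_gt hlt
    rw [Submodule.disjoint_def] at hnd
    push Not at hnd
    obtain ⟨e, he, heE, he0⟩ := hnd
    obtain ⟨k, hk, z, hz, rfl⟩ := Submodule.mem_sup.mp he
    obtain ⟨r, rfl⟩ := Submodule.mem_span_singleton.mp hz
    exact ⟨r, k, hk, heE, he0⟩
  have hinj : Function.Injective (K.mkQ ∘ₗ E.subtype) := by
    rw [← LinearMap.ker_eq_bot, LinearMap.ker_eq_bot']
    intro x hx
    exact Subtype.ext (Submodule.disjoint_def.mp hK.prop x.1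
      (by simpa using hx) x.2)
  obtain ⟨h, hh⟩ := Module.Injective.extension_property R Q E (Q ⧸ K) (K.mkQ ∘ₗ E.subtype) hinj E.subtype
  have hh' : ∀ x ∈ E, h (K.mkQ x) = x := fun x hx => LinearMap.congr_fun hh ⟨x, hx⟩
  -- The image of `h` contains `E` and is still essential over `N`, so maximality of `E` forces
  -- equality.
  have hrange : LinearMap.range (h ∘ₗ K.mkQ) ≤ E := by
    refine hE.le_of_ge ?_ fun x hx => ⟨x, hh' x hx⟩
    rintro _ ⟨x, rfl⟩ hx0
    have hxK : x ∉ K := fun hx => hx0 (by simp [(Submodule.Quotient.mk_eq_zero K).mpr hx])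
    obtain ⟨r, k, hk, heE, he0⟩ := key x hxK
    obtain ⟨s, hs0, hsN⟩ := hE.prop _ heE he0
    have : (s * r) • (h ∘ₗ K.mkQ) x = s • (k + r • x) := by
      have h1 := hh' _ heE
      have h2 : K.mkQ k = 0 := (Submodule.Quotient.mk_eq_zero K).mpr hk
      rw [map_add, h2, zero_add, map_smul, map_smul] at h1
      rw [mul_smul, ← h1]
      rfl
    exact ⟨s * r, this ▸ hs0, this ▸ hsN⟩
  exact ⟨(h ∘ₗ K.mkQ).codRestrict E fun x => hrange ⟨x, rfl⟩,
    fun x => Subtype.ext (hh' x.1 x.2)⟩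

/-- Every module embeds essentially into an injective module. -/
theorem exists_essential_injective (N : Type u) [AddCommGroup N] [Module R N] :
    ∃ (E : Type u) (_ : AddCommGroup E) (_ : Module R E) (f : N →ₗ[R] E),
      Module.Injective R E ∧ Function.Injective f ∧
        ∀ x : E, x ≠ 0 → ∃ r : R, r • x ≠ 0 ∧ r • x ∈ LinearMap.range f := by
  let P := (EnoughInjectives.presentation (ModuleCat.of R N)).some
  let Q := P.J
  have : CategoryTheory.Injective (ModuleCat.of R Q) := P.injective
  have : Module.Injective R Q := Module.injective_module_of_injective_object R Q
  let i : N →ₗ[R] Q := P.f.hom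
  have hi : Function.Injective i := (ModuleCat.mono_iff_injective P.f).mp P.mono
  obtain ⟨E, hNE, hE⟩ := exists_maximal_essential (LinearMap.range i)
  obtain ⟨p, hp⟩ := exists_retraction_of_maximal_essential hE
  refine ⟨E, inferInstance, inferInstance, i.codRestrict E fun x => hNE ⟨x, rfl⟩, ⟨?_⟩, ?_, ?_⟩
  · intro X Y _ _ _ _ f hf g
    obtain ⟨h, hh⟩ := Module.Injective.out f hf (E.subtype ∘ₗ g)
    exact ⟨p ∘ₗ h, fun x => by simp [hh, hp]⟩
  · exact fun x y hxy => hi congr(($hxy : Q))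
  · intro x hx
    obtain ⟨r, hr0, y, hy⟩ := hE.prop x.1 x.2 (by simpa using hx)
    exact ⟨r, fun h => hr0 congr(($h : Q)), y, Subtype.ext hy⟩

end Hull

/-! ### Spliced injective resolutions and dimension shifting for derived functors -/

section Resolution

variable {C : Type u} [Category.{v} C] [Abelian C]

/-- The augmentation `Z ⟶ P⁰` of an injective resolution. -/
def augmentation {Z : C} (P : InjectiveResolution Z) : Z ⟶ P.cocomplex.X 0 := P.ι.f 0

theorem augmentation_comp_d {Z : C} (P : InjectiveResolution Z) :
    augmentation P ≫ P.cocomplex.d 0 1 = 0 := P.ι_f_zero_comp_complex_d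

theorem augmentation_exact {Z : C} (P : InjectiveResolution Z) :
    (ShortComplex.mk _ _ (augmentation_comp_d P)).Exact := P.exact₀

instance mono_augmentation {Z : C} (P : InjectiveResolution Z) : Mono (augmentation P) :=
  inferInstanceAs (Mono (P.ι.f 0))

/-- The cochain complex `X₂ ⟶ P⁰ ⟶ P¹ ⟶ ⋯` obtained from `X₁ ⟶ X₂ ⟶ X₃` and a resolution of
`X₃`. -/
noncomputable def spliceComplex (S : ShortComplex C) (P : InjectiveResolution S.X₃) :
    CochainComplex C ℕ :=
  CochainComplex.augment P.cocomplex (X := S.X₂) (S.g ≫ augmentation P)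
    (by rw [Category.assoc, augmentation_comp_d, Limits.comp_zero])

theorem spliceComplex_f_comp_d (S : ShortComplex C) (P : InjectiveResolution S.X₃) :
    S.f ≫ (S.g ≫ augmentation P) = 0 := by
  rw [S.zero_assoc, Limits.zero_comp]

theorem spliceComplex_exact_zero {S : ShortComplex C} (hS : S.ShortExact)
    (P : InjectiveResolution S.X₃) :
    (ShortComplex.mk S.f (S.g ≫ augmentation P) (spliceComplex_f_comp_d S P)).Exact := by
  let φ : S ⟶ ShortComplex.mk S.f (S.g ≫ augmentation P) (spliceComplex_f_comp_d S P) :=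
    { τ₁ := 𝟙 _, τ₂ := 𝟙 _, τ₃ := augmentation P }
  have : Mono φ.τ₃ := inferInstanceAs (Mono (augmentation P))
  have : Epi φ.τ₁ := inferInstanceAs (Epi (𝟙 S.X₁))
  have : IsIso φ.τ₂ := inferInstanceAs (IsIso (𝟙 S.X₂))
  exact (ShortComplex.exact_iff_of_epi_of_isIso_of_mono φ).mp hS.exact

theorem spliceComplex_exactAt_succ {S : ShortComplex C} (hS : S.ShortExact)
    (P : InjectiveResolution S.X₃) (n : ℕ) : (spliceComplex S P).ExactAt (n + 1) := by
  have : Epi S.g := hS.epi_g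
  rw [HomologicalComplex.exactAt_iff' _ n (n + 1) (n + 2) (by simp) (by simp)]
  rcases n with _ | n
  · let φ : ShortComplex.mk (S.g ≫ augmentation P) (P.cocomplex.d 0 1)
        (by rw [Category.assoc, augmentation_comp_d, Limits.comp_zero]) ⟶
        ShortComplex.mk _ _ (augmentation_comp_d P) :=
      { τ₁ := S.g, τ₂ := 𝟙 _, τ₃ := 𝟙 _ }
    have : Mono φ.τ₃ := inferInstanceAs (Mono (𝟙 (P.cocomplex.X 1)))
    have : Epi φ.τ₁ := inferInstanceAs (Epi S.g)
    have : IsIso φ.τ₂ := inferInstanceAs (IsIso (𝟙 (P.cocomplex.X 0)))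
    exact (ShortComplex.exact_iff_of_epi_of_isIso_of_mono φ).mpr (augmentation_exact P)
  · exact P.exact_succ n

/-- Splicing a short exact sequence `X₁ ⟶ X₂ ⟶ X₃` with `X₂` injective and an injective resolution
of `X₃` gives an injective resolution of `X₁`. -/
noncomputable def spliceResolution {S : ShortComplex C} (hS : S.ShortExact) [Injective S.X₂]
    (P : InjectiveResolution S.X₃) : InjectiveResolution S.X₁ where
  cocomplex := spliceComplex S P
  injective n := match n with
    | 0 => inferInstanceAs (Injective S.X₂)
    | n + 1 => P.injective n
  ι := (CochainComplex.fromSingle₀Equiv _ _).symm ⟨S.f, spliceComplex_f_comp_d S P⟩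
  quasiIso := ⟨fun n => by
    have : Mono S.f := hS.mono_f
    cases n
    · rw [CochainComplex.quasiIsoAt₀_iff, ShortComplex.quasiIso_iff_of_zeros]
      · refine (ShortComplex.exact_and_mono_f_iff_of_iso ?_).2
          ⟨spliceComplex_exact_zero hS P, by dsimp; infer_instance⟩
        exact ShortComplex.isoMk (Iso.refl _) (Iso.refl _) (Iso.refl _)
          ((Category.id_comp S.f).trans
            ((CochainComplex.fromSingle₀Equiv_symm_apply_f_zero (C := spliceComplex S P) S.f
              (spliceComplex_f_comp_d S P)).symm.trans (Category.comp_id _).symm))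
          ((Category.id_comp (S.g ≫ augmentation P)).trans
            (Category.comp_id (S.g ≫ augmentation P)).symm)
      all_goals rfl
    · rw [quasiIsoAt_iff_exactAt]
      · exact spliceComplex_exactAt_succ hS P _
      · apply CochainComplex.exactAt_succ_single_obj⟩

variable {D : Type*} [Category* D] [Abelian D] [EnoughInjectives C]

/-- Dimension shifting for right derived functors along a short exact sequence whose middle term
is injective and killed by the functor. -/
theorem nonempty_rightDerived_succ_iso {S : ShortComplex C} (hS : S.ShortExact) [Injective S.X₂]
    (F : C ⥤ D) [F.Additive] (hF : Limits.IsZero (F.obj S.X₂)) (n : ℕ) :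
    Nonempty ((F.rightDerived (n + 1)).obj S.X₁ ≅ (F.rightDerived n).obj S.X₃) := by
  let P := injectiveResolution S.X₃
  let K := (F.mapHomologicalComplex (.up ℕ)).obj P.cocomplex
  let L := (F.mapHomologicalComplex (.up ℕ)).obj (spliceResolution hS P).cocomplex
  suffices h : Nonempty (L.homology (n + 1) ≅ K.homology n) by
    obtain ⟨e⟩ := h
    exact ⟨(spliceResolution hS P).isoRightDerivedObj F (n + 1) ≪≫ e ≪≫
      (P.isoRightDerivedObj F n).symm⟩
  rcases n with _ | n
  -- In degree 0 the predecessor index is 0 itself, with zero differential. The zero map on the left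
  -- is epi because `L.X 0 = F.obj S.X₂` vanishes.
  · let φ : K.sc' 0 0 1 ⟶ L.sc' 0 1 2 :=
      ⟨0, 𝟙 (K.X 0), 𝟙 (K.X 1), by
        have : (K.sc' 0 0 1).f = 0 := K.shape 0 0 (by simp)
        rw [this, Limits.zero_comp]
        exact Limits.zero_comp.symm,
        (Category.id_comp (K.d 0 1)).trans (Category.comp_id (K.d 0 1)).symm⟩
    have : Epi φ.τ₁ := ⟨fun _ _ _ => hF.eq_of_src _ _⟩
    have : IsIso φ.τ₂ := inferInstanceAs (IsIso (𝟙 _))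
    have : Mono φ.τ₃ := inferInstanceAs (Mono (𝟙 _))
    have := ShortComplex.quasiIso_of_epi_of_isIso_of_mono φ
    exact ⟨(ShortComplex.homologyMapIso (L.isoSc' 0 1 2 (by simp) (by simp))) ≪≫
      (asIso (ShortComplex.homologyMap φ)).symm ≪≫
      (ShortComplex.homologyMapIso (K.isoSc' 0 0 1 (by simp) (by simp))).symm⟩
  · have e : L.sc' (n + 1) (n + 2) (n + 3) = K.sc' n (n + 1) (n + 2) := rfl
    exact ⟨(ShortComplex.homologyMapIso (L.isoSc' (n + 1) (n + 2) (n + 3) (by simp) (by simp))) ≪≫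
      ShortComplex.homologyMapIso (eqToIso e) ≪≫
      (ShortComplex.homologyMapIso (K.isoSc' n (n + 1) (n + 2) (by simp) (by simp))).symm⟩

end Resolution

/-! ### Dimension shifting for `Ext` -/

section Ext

variable {C : Type u} [Category.{v} C] [Abelian C] [HasExt.{v} C]

/-- Dimension shifting for `Ext`. -/
theorem nonempty_ext_equiv_ext_succ {R : Type*} [CommRing R] [Linear R C] (A : C)
    {S : ShortComplex C} (hS : S.ShortExact) (n : ℕ)
    (hg : ∀ x : Ext A S.X₂ n, x.comp (Ext.mk₀ S.g) (add_zero n) = 0)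
    (hf : ∀ x : Ext A S.X₁ (n + 1), x.comp (Ext.mk₀ S.f) (add_zero (n + 1)) = 0) :
    Nonempty (Ext A S.X₃ n ≃ₗ[R] Ext A S.X₁ (n + 1)) := by
  refine ⟨LinearEquiv.ofBijective (hS.extClass.postcompOfLinear R A (rfl : n + 1 = n + 1))
    ⟨?_, fun x => Ext.covariant_sequence_exact₁ A hS x (hf x) rfl⟩⟩
  rw [← LinearMap.ker_eq_bot, LinearMap.ker_eq_bot']
  intro x hx
  obtain ⟨y, rfl⟩ := Ext.covariant_sequence_exact₃ A hS x rfl hx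
  exact hg y

end Ext

/-! ### Torsion functors given by a set of ideals -/

section TorsionFunctor

variable {R : Type u} [CommRing R]

/-- `F` is, via `ι`, the subfunctor of the identity functor that consists of the elements whose
annihilator belongs to the up-closed set `W` of ideals. -/
structure IsTorsionFunctor (F : ModuleCat.{u} R ⥤ ModuleCat.{u} R) (ι : F ⟶ 𝟭 _)
    (W : Set (Ideal R)) : Prop where
  isUpperSet : IsUpperSet W
  injective (N : ModuleCat.{u} R) : Function.Injective (ι.app N).hom
  mem_range_iff (N : ModuleCat.{u} R) (x : N) :
    x ∈ LinearMap.range (ι.app N).hom ↔ Ideal.torsionOf R N x ∈ W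

variable {F : ModuleCat.{u} R ⥤ ModuleCat.{u} R} {ι : F ⟶ 𝟭 _} {W : Set (Ideal R)}

theorem torsionOf_map_of_injective {N P : Type*} [AddCommGroup N] [Module R N] [AddCommGroup P]
    [Module R P] {f : N →ₗ[R] P} (hf : Function.Injective f) (x : N) :
    Ideal.torsionOf R P (f x) = Ideal.torsionOf R N x := by
  ext r
  rw [Ideal.mem_torsionOf_iff, Ideal.mem_torsionOf_iff, ← map_smul, map_eq_zero_iff f hf]

theorem torsionOf_le_torsionOf_map {N P : Type*} [AddCommGroup N] [Module R N] [AddCommGroup P]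
    [Module R P] (f : N →ₗ[R] P) (x : N) :
    Ideal.torsionOf R N x ≤ Ideal.torsionOf R P (f x) := fun r hr => by
  rw [Ideal.mem_torsionOf_iff] at hr ⊢
  rw [← map_smul, hr, map_zero]

theorem nontrivial_hom_quotient {N : Type*} [AddCommGroup N] [Module R N] {𝔞 : Ideal R} {x : N}
    (hx : x ≠ 0) (h : 𝔞 ≤ Ideal.torsionOf R N x) : Nontrivial (R ⧸ 𝔞 →ₗ[R] N) := by
  refine ⟨Submodule.liftQ 𝔞 (LinearMap.toSpanSingleton R N x) h, 0, fun h0 => hx ?_⟩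
  exact (one_smul R x).symm.trans (LinearMap.congr_fun h0 (Submodule.Quotient.mk 1))

namespace IsTorsionFunctor

theorem torsionOf_mem (h : IsTorsionFunctor F ι W) {N : ModuleCat.{u} R} (x : F.obj N) :
    Ideal.torsionOf R (F.obj N) x ∈ W := by
  rw [← torsionOf_map_of_injective (h.injective N) x]
  exact (h.mem_range_iff N _).mp ⟨x, rfl⟩

/-- An injection preserves annihilators, so a torsion element of `S.X₂` killed by `S.g` comes from a
torsion element of `S.X₁`. Left exactness is what identifies `R^0 F` with `F`. -/
theorem preservesFiniteLimits [F.Additive] (h : IsTorsionFunctor F ι W) :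
    Limits.PreservesFiniteLimits F := by
  rw [Functor.preservesFiniteLimits_iff_forall_exact_map_and_mono]
  intro S hS
  have hmono : Function.Injective S.f.hom := (ModuleCat.mono_iff_injective S.f).mp hS.mono_f
  have nat {X Y : ModuleCat.{u} R} (f : X ⟶ Y) (x : F.obj X) :
      (ι.app Y).hom ((F.map f).hom x) = f.hom ((ι.app X).hom x) :=
    LinearMap.congr_fun (congrArg ModuleCat.Hom.hom (ι.naturality f)) x
  constructor
  · rw [ShortComplex.moduleCat_exact_iff]
    intro x hx
    have h1 : S.g.hom ((ι.app S.X₂).hom x) = 0 := by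
      exact (nat S.g x).symm.trans ((congrArg _ hx).trans (map_zero _))
    obtain ⟨y, hy⟩ := (ShortComplex.moduleCat_exact_iff S).mp hS.exact _ h1
    obtain ⟨z, rfl⟩ : y ∈ LinearMap.range (ι.app S.X₁).hom := by
      rw [h.mem_range_iff, ← torsionOf_map_of_injective hmono]
      exact (h.mem_range_iff S.X₂ _).mp ⟨x, hy.symm⟩
    exact ⟨z, h.injective _ ((nat S.f z).trans hy)⟩
  · rw [ModuleCat.mono_iff_injective]
    intro x y hxy
    exact h.injective _ (hmono ((nat S.f x).symm.trans ((congrArg _ hxy).trans (nat S.f y))))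

/-- Maps from a cyclic module with annihilator in `W` land in the torsion part. -/
theorem nonempty_hom_equiv (h : IsTorsionFunctor F ι W) (N : ModuleCat.{u} R) {𝔞 : Ideal R}
    (h𝔞 : 𝔞 ∈ W) : Nonempty ((R ⧸ 𝔞 →ₗ[R] F.obj N) ≃ₗ[R] (R ⧸ 𝔞 →ₗ[R] N)) := by
  refine ⟨LinearEquiv.ofBijective ((ι.app N).hom.compRight R : (R ⧸ 𝔞 →ₗ[R] F.obj N) →ₗ[R] _)
    ⟨fun f g hfg => ?_, fun f => ?_⟩⟩
  · ext
    exact h.injective N (LinearMap.congr_fun hfg 1)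
  · have hf : ∀ x, f x ∈ LinearMap.range (ι.app N).hom := fun x => by
      refine (h.mem_range_iff N _).mpr (h.isUpperSet (fun r hr => ?_) h𝔞)
      rw [Ideal.mem_torsionOf_iff, ← map_smul]
      obtain ⟨x, rfl⟩ := Ideal.Quotient.mk_surjective x
      have : r • (Ideal.Quotient.mk 𝔞 x) = 0 :=
        Ideal.Quotient.eq_zero_iff_mem.mpr (𝔞.mul_mem_right x hr)
      rw [this, map_zero]
    refine ⟨(LinearEquiv.ofInjective _ (h.injective N)).symm.toLinearMap ∘ₗ
      f.codRestrict _ hf, LinearMap.ext fun x => ?_⟩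
    exact congrArg Subtype.val
      ((LinearEquiv.ofInjective _ (h.injective N)).apply_symm_apply (f.codRestrict _ hf x))

theorem subsingleton_obj (h : IsTorsionFunctor F ι W) {N : ModuleCat.{u} R}
    (hN : ∀ x : N, Ideal.torsionOf R N x ∈ W → x = 0) : Subsingleton (F.obj N) := by
  refine subsingleton_of_forall_eq 0 fun x => h.injective N ?_
  rw [map_zero]
  exact hN _ ((h.mem_range_iff N _).mp ⟨x, rfl⟩)

end IsTorsionFunctor

/-- If `Ext^i(R/𝔞, N) = 0` for all `i < t` and `𝔞 ∈ W`, then `R^t F` is computed, up to maps from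
`R/𝔞`, by `Ext^t`. -/
theorem IsTorsionFunctor.rightDerived_spec [F.Additive] (h : IsTorsionFunctor F ι W) (t : ℕ)
    (N : ModuleCat.{u} R)
    (hN : ∀ i < t, ∀ 𝔞 ∈ W, Subsingleton (Ext (ModuleCat.of R (R ⧸ 𝔞)) N i)) :
    (∀ 𝔞 ∈ W, Nonempty ((R ⧸ 𝔞 →ₗ[R] (F.rightDerived t).obj N) ≃ₗ[R]
      Ext (ModuleCat.of R (R ⧸ 𝔞)) N t)) ∧
    ∀ y : (F.rightDerived t).obj N, Ideal.torsionOf R _ y ∈ W := by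
  induction t generalizing N with
  | zero =>
    have := h.preservesFiniteLimits
    let e := (F.rightDerivedZeroIsoSelf.app N).toLinearEquiv
    refine ⟨fun 𝔞 h𝔞 => ?_, fun y => ?_⟩
    · obtain ⟨e'⟩ := h.nonempty_hom_equiv N h𝔞
      exact ⟨(e.congrRight.trans e').trans
        ((Ext.linearEquiv₀ (R := R)).trans ModuleCat.homLinearEquiv).symm⟩
    · rw [← torsionOf_map_of_injective (f := e.toLinearMap) e.injective y]
      exact h.torsionOf_mem _
  | succ t ih =>
    -- A nonzero such `x` would give a nonzero map from `R ⧸ Ann x`, against the vanishing of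
    -- `Ext^0`.
    have hNtors : ∀ x : N, Ideal.torsionOf R N x ∈ W → x = 0 := by
      intro x hx
      have := hN 0 t.succ_pos _ hx
      have := ((Ext.linearEquiv₀ (R := R)).trans
        (ModuleCat.homLinearEquiv (M := ModuleCat.of R (R ⧸ Ideal.torsionOf R N x))
          (N := N))).symm.toEquiv.subsingleton
      by_contra hx0
      exact not_nontrivial_iff_subsingleton.mpr this (nontrivial_hom_quotient hx0 le_rfl)
    obtain ⟨E, _, _, f, hE, hf, hess⟩ := exists_essential_injective (R := R) N
    -- A nonzero multiple of `x` in `N` has a larger annihilator, hence is again `W`-torsion.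
    have hEtors : ∀ x : E, Ideal.torsionOf R E x ∈ W → x = 0 := by
      intro x hx
      by_contra hx0
      obtain ⟨r, hr0, y, hy⟩ := hess x hx0
      refine hr0 ?_
      rw [← hy, hNtors y, map_zero]
      rw [← torsionOf_map_of_injective hf y, hy]
      exact h.isUpperSet (torsionOf_le_torsionOf_map (LinearMap.lsmul R E r) x) hx
    let S : ShortComplex (ModuleCat.{u} R) :=
      ModuleCat.shortComplexOfCompEqZero f (LinearMap.range f).mkQ
        (LinearMap.range_mkQ_comp f)
    have hS : S.ShortExact :=
      { exact := ModuleCat.shortComplex_exact _ (LinearMap.exact_map_mkQ_range f)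
        mono_f := (ModuleCat.mono_iff_injective _).mpr hf
        epi_g := (ModuleCat.epi_iff_surjective _).mpr (Submodule.mkQ_surjective _) }
    have : CategoryTheory.Injective S.X₂ := Module.injective_object_of_injective_module R E
    have hFE : Limits.IsZero (F.obj S.X₂) :=
      ModuleCat.isZero_of_iff_subsingleton.mpr (h.subsingleton_obj (N := S.X₂) hEtors)
    have hhom : ∀ 𝔞 ∈ W, Subsingleton (Ext (ModuleCat.of R (R ⧸ 𝔞)) S.X₂ 0) := by
      intro 𝔞 h𝔞
      obtain ⟨e⟩ := h.nonempty_hom_equiv S.X₂ h𝔞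
      have := h.subsingleton_obj (N := S.X₂) hEtors
      exact ((Ext.linearEquiv₀ (R := R)).trans
        (ModuleCat.homLinearEquiv.trans e.symm)).toEquiv.subsingleton
    have shift : ∀ 𝔞 ∈ W, ∀ i, Nonempty (Ext (ModuleCat.of R (R ⧸ 𝔞)) S.X₃ i ≃ₗ[R]
        Ext (ModuleCat.of R (R ⧸ 𝔞)) N (i + 1)) := by
      intro 𝔞 h𝔞 i
      refine nonempty_ext_equiv_ext_succ _ hS i (fun x => ?_) fun x => Ext.eq_zero_of_injective _
      have : x = 0 := by
        cases i with
        | zero =>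
          have := hhom 𝔞 h𝔞
          exact Subsingleton.elim _ _
        | succ i => exact Ext.eq_zero_of_injective _
      rw [this, Ext.zero_comp]
    obtain ⟨h1, h2⟩ := ih S.X₃ fun i hi 𝔞 h𝔞 => by
      obtain ⟨e⟩ := shift 𝔞 h𝔞 i
      have := hN (i + 1) (by omega) 𝔞 h𝔞
      exact e.toEquiv.subsingleton
    obtain ⟨e⟩ := nonempty_rightDerived_succ_iso hS F hFE t
    let e' := e.toLinearEquiv
    refine ⟨fun 𝔞 h𝔞 => ?_, fun y => ?_⟩
    · obtain ⟨a⟩ := h1 𝔞 h𝔞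
      obtain ⟨b⟩ := shift 𝔞 h𝔞 t
      exact ⟨(e'.congrRight.trans a).trans b⟩
    · rw [← torsionOf_map_of_injective (f := e'.toLinearMap) e'.injective y]
      exact h2 _

/-- The inclusion of `Γ_{I,J}` into the identity functor. -/
def pairTorsionInclusion (I J : Ideal R) : pairTorsionFunctor I J ⟶ 𝟭 (ModuleCat.{u} R) where
  app N := ModuleCat.ofHom (pairTorsion I J N).subtype

/-- The inclusion of `Γ_I` into the identity functor. -/
def torsionInclusion (I : Ideal R) : torsionFunctor I ⟶ 𝟭 (ModuleCat.{u} R) where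
  app N := ModuleCat.ofHom (torsion I N).subtype

theorem isUpperSet_tildeW (I J : Ideal R) : IsUpperSet (tildeW I J) :=
  fun _ _ hab ⟨n, hn, h⟩ => ⟨n, hn, h.trans (sup_le_sup_right hab J)⟩

theorem self_mem_tildeW (I J : Ideal R) : I ∈ tildeW I J :=
  ⟨1, le_rfl, by rw [pow_one]; exact le_sup_left⟩

theorem tildeW_bot_subset (I J : Ideal R) : tildeW I ⊥ ⊆ tildeW I J :=
  fun _ ⟨n, hn, h⟩ => ⟨n, hn, h.trans (sup_le_sup_left bot_le _)⟩

theorem mem_pairTorsion_iff (I J : Ideal R) {N : Type u} [AddCommGroup N] [Module R N] (x : N) :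
    x ∈ pairTorsion I J N ↔ Ideal.torsionOf R N x ∈ tildeW I J := by
  constructor
  · rintro ⟨n, hn⟩
    -- `tildeW` requires a positive exponent, whereas `pairTorsion` allows 0.
    refine ⟨n + 1, by omega, fun a ha => ?_⟩
    obtain ⟨b, hb, hab⟩ := hn a (Ideal.pow_le_pow_right n.le_succ ha)
    refine Submodule.mem_sup.mpr ⟨a - b, ?_, b, hb, sub_add_cancel a b⟩
    rw [Ideal.mem_torsionOf_iff, sub_smul, hab, sub_self]
  · rintro ⟨n, -, hn⟩
    refine ⟨n, fun a ha => ?_⟩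
    obtain ⟨c, hc, b, hb, rfl⟩ := Submodule.mem_sup.mp (hn ha)
    rw [Ideal.mem_torsionOf_iff] at hc
    exact ⟨b, hb, by rw [add_smul, hc, zero_add]⟩

theorem torsion_eq_pairTorsion_bot (I : Ideal R) (N : Type u) [AddCommGroup N] [Module R N] :
    torsion I N = pairTorsion I ⊥ N := by
  ext x
  exact exists_congr fun n => forall₂_congr fun a _ => by simp

theorem isTorsionFunctor_pairTorsionFunctor (I J : Ideal R) :
    IsTorsionFunctor (pairTorsionFunctor I J) (pairTorsionInclusion I J) (tildeW I J) where
  isUpperSet := isUpperSet_tildeW I J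
  injective N := (pairTorsion I J N).subtype_injective
  mem_range_iff N x := by
    rw [← mem_pairTorsion_iff, ← (pairTorsion I J N).range_subtype]
    rfl

theorem isTorsionFunctor_torsionFunctor (I : Ideal R) :
    IsTorsionFunctor (torsionFunctor I) (torsionInclusion I) (tildeW I ⊥) where
  isUpperSet := isUpperSet_tildeW I ⊥
  injective N := (torsion I N).subtype_injective
  mem_range_iff N x := by
    rw [← mem_pairTorsion_iff, ← torsion_eq_pairTorsion_bot, ← (torsion I N).range_subtype]
    rfl

end TorsionFunctor

/-! ### Depth and vanishing of `Ext` -/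

section Depth

variable {R : Type u} [CommRing R]

theorem nonempty_ext_quotSMulTop_equiv {N : Type u} [AddCommGroup N] [Module R N] {M : Type u}
    [AddCommGroup M] [Module R M] {x : R} (hx : IsSMulRegular M x)
    (hxN : x ∈ Module.annihilator R N) (n : ℕ)
    (h : Subsingleton (Ext (ModuleCat.of R N) (ModuleCat.of R M) n)) :
    Nonempty (Ext (ModuleCat.of R N) (ModuleCat.of R (QuotSMulTop x M)) n ≃ₗ[R]
      Ext (ModuleCat.of R N) (ModuleCat.of R M) (n + 1)) := by
  have hx' : IsSMulRegular (ModuleCat.of R M) x := hx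
  refine nonempty_ext_equiv_ext_succ _ hx'.smulShortComplex_shortExact n (fun y => ?_) fun y => ?_
  · have : y = 0 := h.elim y 0
    rw [this, Ext.zero_comp]
  -- Multiplication by `x` on `M` acts as zero on `Ext` because `x` kills `N`.
  · exact congrArg (fun f => f.hom y)
      (Ext.postcomp_smul_id_eq_zero_of_mem_annihilator (M := ModuleCat.of R M)
        (N := ModuleCat.of R N) hxN (n + 1))

/-- Along a weakly `M`-regular sequence in the annihilator of `N`, `Ext` shifts to degree zero. -/
theorem nonempty_ext_length_equiv {N : Type u} [AddCommGroup N] [Module R N] (xs : List R)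
    (hxs : ∀ x ∈ xs, x ∈ Module.annihilator R N) {M : Type u} [AddCommGroup M] [Module R M]
    (hreg : IsWeaklyRegular M xs)
    (h : ∀ i < xs.length, Subsingleton (Ext (ModuleCat.of R N) (ModuleCat.of R M) i)) :
    Nonempty (Ext (ModuleCat.of R N) (ModuleCat.of R M) xs.length ≃ₗ[R]
      (N →ₗ[R] M ⧸ (Ideal.ofList xs • ⊤ : Submodule R M))) := by
  induction xs generalizing M with
  | nil =>
    have e : M ≃ₗ[R] M ⧸ (Ideal.ofList ([] : List R) • ⊤ : Submodule R M) :=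
      (Submodule.quotEquivOfEqBot _ (by simp)).symm
    exact ⟨((Ext.linearEquiv₀ (R := R)).trans ModuleCat.homLinearEquiv).trans e.congrRight⟩
  | cons x xs ih =>
    rw [isWeaklyRegular_cons_iff] at hreg
    have hshift : ∀ i < xs.length + 1, _ := fun i hi =>
      nonempty_ext_quotSMulTop_equiv hreg.1 (hxs x List.mem_cons_self) i (h i hi)
    obtain ⟨a⟩ := ih (fun y hy => hxs y (List.mem_cons_of_mem x hy)) hreg.2 fun i hi => by
      obtain ⟨e⟩ := hshift i (by omega)
      have := h (i + 1) (by simpa using hi)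
      exact e.toEquiv.subsingleton
    obtain ⟨b⟩ := hshift xs.length (by omega)
    exact ⟨(b.symm.trans a).trans
      (Submodule.quotOfListConsSMulTopEquivQuotSMulTopInner M x xs).symm.congrRight⟩

theorem natCast_le_depth_iff {𝔞 : Ideal R} {M : Type u} [AddCommGroup M] [Module R M]
    (hM : 𝔞 • (⊤ : Submodule R M) ≠ ⊤) (n : ℕ) :
    (n : ℕ∞) ≤ depth 𝔞 M ↔
      ∃ xs : List R, n ≤ xs.length ∧ (∀ x ∈ xs, x ∈ 𝔞) ∧ IsRegular M xs := by
  rw [depth, if_neg hM]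
  constructor
  · intro h
    rcases n with _ | n
    · have : Nontrivial M := by
        by_contra hnt
        rw [not_nontrivial_iff_subsingleton] at hnt
        exact hM (Subsingleton.elim _ _)
      exact ⟨[], by simp, by simp, .nil R M⟩
    -- The strict bound `n < n + 1 ≤ depth 𝔞 M` lets one sequence in the supremum be chosen.
    · have h' := lt_of_lt_of_le (ENat.natCast_lt_natCast.mpr n.lt_succ_self) h
      obtain ⟨xs, h'⟩ := lt_iSup_iff.mp h'
      obtain ⟨hxs, h'⟩ := lt_iSup_iff.mp h'
      exact ⟨xs, ENat.natCast_lt_natCast.mp h', hxs⟩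
  · rintro ⟨xs, hn, hxs⟩
    exact (ENat.natCast_le_natCast.mpr hn).trans
      (le_iSup₂ (f := fun (xs : List R) (_ : xs ∈ {xs : List R | (∀ x ∈ xs, x ∈ 𝔞) ∧
        IsRegular M xs}) => (xs.length : ℕ∞)) xs hxs)

theorem isWeaklyRegular_take {M : Type u} [AddCommGroup M] [Module R M] {xs : List R}
    (h : IsWeaklyRegular M xs) (n : ℕ) : IsWeaklyRegular M (xs.take n) := by
  rw [← List.take_append_drop n xs, isWeaklyRegular_append_iff] at h
  exact h.1

/-- The determinant trick gives `r ∈ 1 + 𝔞` killing `M`. On `Ext` both `r` and `r - 1` act as zero,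
hence so does 1. This covers the case where the depth is `∞` by convention. -/
theorem subsingleton_ext_of_smul_top_eq_top {𝔞 : Ideal R} {M : Type u} [AddCommGroup M]
    [Module R M] [Module.Finite R M] (hM : 𝔞 • (⊤ : Submodule R M) = ⊤) (n : ℕ) :
    Subsingleton (Ext (ModuleCat.of R (R ⧸ 𝔞)) (ModuleCat.of R M) n) := by
  obtain ⟨r, hr, hrM⟩ := Submodule.exists_sub_one_mem_and_smul_eq_zero_of_fg_of_le_smul 𝔞
    (⊤ : Submodule R M) Module.Finite.fg_top hM.ge
  refine subsingleton_of_forall_eq 0 fun y => ?_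
  have h1 : (r - 1) • y = 0 := by
    have := congrArg (fun f => f.hom y)
      (Ext.postcomp_smul_id_eq_zero_of_mem_annihilator (M := ModuleCat.of R M)
        (N := ModuleCat.of R (R ⧸ 𝔞)) (r := r - 1) (by rwa [Ideal.annihilator_quotient]) n)
    rw [Ext.smul_eq_comp_mk₀]
    exact this
  have h2 : r • y = 0 := by
    rw [Ext.smul_eq_comp_mk₀]
    have : r • 𝟙 (ModuleCat.of R M) = 0 := by
      ext m
      exact hrM m trivial
    rw [this, Ext.mk₀_zero, Ext.comp_zero]
  rw [sub_smul, one_smul, h2, zero_sub, neg_eq_zero] at h1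
  exact h1

variable [IsNoetherianRing R] {M : Type u} [AddCommGroup M] [Module R M] [Module.Finite R M]

theorem natCast_le_depth_iff_subsingleton_ext {𝔞 : Ideal R}
    (hM : 𝔞 • (⊤ : Submodule R M) ≠ ⊤) (n : ℕ) :
    (n : ℕ∞) ≤ depth 𝔞 M ↔
      ∀ i < n, Subsingleton (Ext (ModuleCat.of R (R ⧸ 𝔞)) (ModuleCat.of R M) i) := by
  have hsupp : Module.support R (R ⧸ 𝔞) = PrimeSpectrum.zeroLocus 𝔞 := by
    rw [Module.support_eq_zeroLocus, Ideal.annihilator_quotient]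
  rw [natCast_le_depth_iff hM]
  constructor
  · rintro ⟨xs, hn, hxs, hreg⟩ i hi
    exact ModuleCat.subsingleton_ext_of_exists_isRegular 𝔞 (ModuleCat.of R (R ⧸ 𝔞)) hsupp.subset
      (ModuleCat.of R M) hM.lt_top xs hxs hreg i (by omega)
  · intro h
    obtain ⟨xs, hn, hxs⟩ := ModuleCat.exists_isRegular_of_exists_subsingleton_ext 𝔞 n
      (ModuleCat.of R M) hM.lt_top (ModuleCat.of R (R ⧸ 𝔞)) hsupp h
    exact ⟨xs, hn.ge, hxs⟩

theorem subsingleton_ext_of_lt_depth {𝔞 : Ideal R} {n : ℕ} (h : (n : ℕ∞) < depth 𝔞 M) :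
    Subsingleton (Ext (ModuleCat.of R (R ⧸ 𝔞)) (ModuleCat.of R M) n) := by
  by_cases hM : 𝔞 • (⊤ : Submodule R M) = ⊤
  · exact subsingleton_ext_of_smul_top_eq_top hM n
  · refine (natCast_le_depth_iff_subsingleton_ext hM (n + 1)).mp ?_ n n.lt_succ_self
    exact_mod_cast Order.add_one_le_of_lt h

/-- This gives finiteness of depth. If all `Ext` vanished, take `xs` weakly regular in `𝔞` with `xs
M` maximal. Then `Hom(R/𝔞, M/xs M) = 0` yields `x ∈ 𝔞` regular on `M/xs M`; by maximality `x` also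
kills it. So `xs M = M`, contradicting `𝔞M ≠ M`. -/
theorem exists_not_subsingleton_ext {𝔞 : Ideal R} (hM : 𝔞 • (⊤ : Submodule R M) ≠ ⊤) :
    ∃ n, ¬ Subsingleton (Ext (ModuleCat.of R (R ⧸ 𝔞)) (ModuleCat.of R M) n) := by
  by_contra! hext
  let T : Set (Submodule R M) := {N | ∃ xs : List R, (∀ x ∈ xs, x ∈ 𝔞) ∧
    IsWeaklyRegular M xs ∧ N = Ideal.ofList xs • ⊤}
  obtain ⟨_, ⟨xs, hxs, hreg, rfl⟩, hmax⟩ := set_has_maximal_iff_noetherian.mpr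
    (inferInstanceAs (IsNoetherian R M)) T ⟨_, [], by simp, .nil R M, rfl⟩
  obtain ⟨e⟩ := nonempty_ext_length_equiv (N := R ⧸ 𝔞) xs
    (fun x hx => by rw [Ideal.annihilator_quotient]; exact hxs x hx) hreg fun i _ => hext i
  have := hext xs.length
  have := e.symm.toEquiv.subsingleton
  obtain ⟨x, hx, hxreg⟩ := IsSMulRegular.subsingleton_linearMap_iff.mp this
  rw [Ideal.annihilator_quotient] at hx
  have hnlt := hmax (Ideal.ofList (xs ++ [x]) • ⊤) ⟨xs ++ [x], by simpa [or_imp, forall_and] using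
    ⟨hxs, hx⟩, (isWeaklyRegular_append_iff M xs [x]).mpr
      ⟨hreg, (isWeaklyRegular_singleton_iff _ x).mpr hxreg⟩, rfl⟩
  have hle : Ideal.ofList (xs ++ [x]) • (⊤ : Submodule R M) ≤ Ideal.ofList xs • ⊤ := by
    have h0 : Ideal.ofList xs • (⊤ : Submodule R M) ≤ Ideal.ofList (xs ++ [x]) • ⊤ :=
      Submodule.smul_mono_left (by rw [Ideal.ofList_append]; exact le_sup_left)
    by_contra hnle
    exact hnlt (lt_of_le_not_ge h0 hnle)
  have htop : Ideal.ofList xs • (⊤ : Submodule R M) = ⊤ := by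
    refine eq_top_iff.mpr fun m _ => ?_
    rw [← Submodule.Quotient.mk_eq_zero]
    refine hxreg ?_
    change x • _ = x • _
    rw [smul_zero, ← Submodule.Quotient.mk_smul, Submodule.Quotient.mk_eq_zero]
    refine hle (Submodule.smul_mem_smul ?_ trivial)
    exact Ideal.subset_span (by simp)
  refine hM (eq_top_iff.mpr (htop.ge.trans (Submodule.smul_mono_left ?_)))
  exact Ideal.span_le.mpr hxs

theorem depth_ne_top {𝔞 : Ideal R} (hM : 𝔞 • (⊤ : Submodule R M) ≠ ⊤) : depth 𝔞 M ≠ ⊤ := by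
  intro h
  obtain ⟨n, hn⟩ := exists_not_subsingleton_ext hM
  exact hn (subsingleton_ext_of_lt_depth (h ▸ ENat.natCast_lt_top n))

end Depth

/-! ### The cohomology modules in degree `t` -/

section Main

variable {R : Type u} [CommRing R]

/-- If `I ^ (n + 1)` kills `x`, induction kills every `a • x` with `a ∈ I`, so a nonzero `x` would
define a nonzero map from `R ⧸ I`. -/
theorem eq_zero_of_pow_le_torsionOf {N : Type*} [AddCommGroup N] [Module R N] {I : Ideal R}
    (hN : Subsingleton (R ⧸ I →ₗ[R] N)) (n : ℕ) {x : N} (hx : I ^ n ≤ Ideal.torsionOf R N x) :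
    x = 0 := by
  induction n generalizing x with
  | zero => simpa [Ideal.mem_torsionOf_iff] using hx (x := 1) (by simp)
  | succ n ih =>
    by_contra hx0
    refine not_nontrivial_iff_subsingleton.mpr hN (nontrivial_hom_quotient hx0 fun a ha => ?_)
    refine (Ideal.mem_torsionOf_iff x a).mpr (ih fun b hb => ?_)
    have := hx (x := b * a) (by rw [pow_succ]; exact Ideal.mul_mem_mul hb ha)
    rwa [Ideal.mem_torsionOf_iff, mul_smul] at this

variable {M : Type u} [AddCommGroup M] [Module R M]

theorem exists_isWeaklyRegular_of_natCast_le_depth {I : Ideal R}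
    (hM : I • (⊤ : Submodule R M) ≠ ⊤) {t : ℕ} (ht : (t : ℕ∞) ≤ depth I M) :
    ∃ xs : List R, xs.length = t ∧ (∀ x ∈ xs, x ∈ I) ∧ IsWeaklyRegular M xs := by
  obtain ⟨xs, hlen, hxs, hreg⟩ := (natCast_le_depth_iff hM t).mp ht
  exact ⟨xs.take t, by simpa using hlen, fun x hx => hxs x (List.mem_of_mem_take hx),
    isWeaklyRegular_take hreg.toIsWeaklyRegular t⟩

variable [IsNoetherianRing R] [Module.Finite R M]

theorem pairCohomology_spec (I J : Ideal R) {t : ℕ} (ht : (t : ℕ∞) ≤ pairDepth I J M) :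
    (∀ 𝔞 ∈ tildeW I J, Nonempty ((R ⧸ 𝔞 →ₗ[R] pairCohomology I J t M) ≃ₗ[R]
      Ext (ModuleCat.of R (R ⧸ 𝔞)) (ModuleCat.of R M) t)) ∧
    ∀ y : pairCohomology I J t M, Ideal.torsionOf R _ y ∈ tildeW I J :=
  (isTorsionFunctor_pairTorsionFunctor I J).rightDerived_spec t (ModuleCat.of R M)
    fun _ hi _ h𝔞 => subsingleton_ext_of_lt_depth <|
      (ENat.natCast_lt_natCast.mpr hi).trans_le (ht.trans (iInf₂_le _ h𝔞))

theorem cohomology_spec (I J : Ideal R) {t : ℕ} (ht : (t : ℕ∞) ≤ pairDepth I J M) :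
    (∀ 𝔞 ∈ tildeW I ⊥, Nonempty ((R ⧸ 𝔞 →ₗ[R] cohomology I t M) ≃ₗ[R]
      Ext (ModuleCat.of R (R ⧸ 𝔞)) (ModuleCat.of R M) t)) ∧
    ∀ y : cohomology I t M, Ideal.torsionOf R _ y ∈ tildeW I ⊥ :=
  (isTorsionFunctor_torsionFunctor I).rightDerived_spec t (ModuleCat.of R M)
    fun _ hi _ h𝔞 => subsingleton_ext_of_lt_depth <|
      (ENat.natCast_lt_natCast.mpr hi).trans_le
        (ht.trans (iInf₂_le _ (tildeW_bot_subset I J h𝔞)))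

theorem nontrivial_cohomology_iff (I J : Ideal R) {t : ℕ} (ht : (t : ℕ∞) ≤ pairDepth I J M)
    (hM : I • (⊤ : Submodule R M) ≠ ⊤) :
    Nontrivial (cohomology I t M) ↔ depth I M = t := by
  obtain ⟨h1, h2⟩ := cohomology_spec I J ht
  obtain ⟨e⟩ := h1 I (self_mem_tildeW I ⊥)
  have hle : (t : ℕ∞) ≤ depth I M := ht.trans (iInf₂_le _ (self_mem_tildeW I J))
  -- Every element of `H^t_I(M)` is killed by a power of `I`, so `Hom(R/I, -)` detects whether it is
  -- zero.
  have key : Subsingleton (cohomology I t M) ↔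
      Subsingleton (Ext (ModuleCat.of R (R ⧸ I)) (ModuleCat.of R M) t) := by
    rw [← e.toEquiv.subsingleton_congr]
    refine ⟨fun h => inferInstance, fun h => subsingleton_of_forall_eq 0 fun y => ?_⟩
    obtain ⟨n, -, hn⟩ := h2 y
    exact eq_zero_of_pow_le_torsionOf h n (by simpa using hn)
  rw [← not_subsingleton_iff_nontrivial, key, not_iff_comm]
  constructor
  · exact fun hne => subsingleton_ext_of_lt_depth (lt_of_le_of_ne hle (Ne.symm hne))
  · intro h heq
    have : ((t + 1 : ℕ) : ℕ∞) ≤ depth I M := by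
      refine (natCast_le_depth_iff_subsingleton_ext hM (t + 1)).mpr fun i hi => ?_
      rcases (Nat.lt_succ_iff_lt_or_eq.mp hi) with hi | rfl
      · exact subsingleton_ext_of_lt_depth ((ENat.natCast_lt_natCast.mpr hi).trans_le hle)
      · exact h
    rw [heq, ENat.natCast_le_natCast] at this
    omega

/-- Being the annihilator of an element of `H^t_{I,J}(M)` puts `𝔭` in `tildeW I J`, so its depth is
at least `t`. That element also gives a nonzero map from `R ⧸ 𝔭`, so `Ext^t(R/𝔭, M) ≠ 0` and the
depth is at most `t`. -/
theorem depth_eq_of_mem_associatedPrimes (I J : Ideal R) {t : ℕ}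
    (ht : (t : ℕ∞) ≤ pairDepth I J M) {𝔭 : Ideal R}
    (h𝔭 : 𝔭 ∈ associatedPrimes R (pairCohomology I J t M)) : depth 𝔭 M = t := by
  obtain ⟨h1, h2⟩ := pairCohomology_spec I J ht
  obtain ⟨hprime, y, hy⟩ := isAssociatedPrime_iff.mp h𝔭
  have hy' : 𝔭 = Ideal.torsionOf R _ y := by
    rw [hy]
    ext r
    rw [Submodule.mem_colon_singleton, Ideal.mem_torsionOf_iff, Submodule.mem_bot]
  have h𝔭W : 𝔭 ∈ tildeW I J := hy' ▸ h2 y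
  refine le_antisymm ?_ (ht.trans (iInf₂_le _ h𝔭W))
  by_contra! hlt
  have := subsingleton_ext_of_lt_depth hlt
  obtain ⟨e⟩ := h1 𝔭 h𝔭W
  refine not_nontrivial_iff_subsingleton.mpr e.toEquiv.subsingleton
    (nontrivial_hom_quotient (x := y) ?_ hy'.le)
  rintro rfl
  exact hprime.ne_top (by rw [hy', Ideal.torsionOf_zero])

end Main

end PairDepth

theorem theorem3p9 {R : Type u} [CommRing R] [IsNoetherianRing R] (I J : Ideal R)
    (M : Type u) [AddCommGroup M] [Module R M] [Module.Finite R M]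
    (hM : I • (⊤ : Submodule R M) ≠ ⊤) :
    ∃ t : ℕ, PairDepth.pairDepth I J M = t ∧
      (Nontrivial (PairDepth.cohomology I t M) ↔ PairDepth.depth I M = t) ∧
      (Nontrivial (PairDepth.cohomology I t M) →
        ∀ 𝔞 ∈ PairDepth.tildeW I J, PairDepth.depth I M ≤ PairDepth.depth 𝔞 M) ∧
      (∀ 𝔭 ∈ associatedPrimes R (PairDepth.pairCohomology I J t M),
        PairDepth.depth 𝔭 M = t) ∧
      (∀ 𝔭 ∈ associatedPrimes R (PairDepth.pairCohomology I J t M),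
        ∀ 𝔞 ∈ PairDepth.tildeW I J, PairDepth.depth 𝔭 M ≤ PairDepth.depth 𝔞 M) ∧
      Nonempty ((R ⧸ I →ₗ[R] PairDepth.pairCohomology I J t M) ≃ₗ[R]
        CategoryTheory.Abelian.Ext (ModuleCat.of R (R ⧸ I)) (ModuleCat.of R M) t) ∧
      Nonempty (CategoryTheory.Abelian.Ext (ModuleCat.of R (R ⧸ I)) (ModuleCat.of R M) t ≃ₗ[R]
        (R ⧸ I →ₗ[R] PairDepth.cohomology I t M)) ∧
      (∃ xs : List R, xs.length = t ∧ (∀ x ∈ xs, x ∈ I) ∧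
        RingTheory.Sequence.IsWeaklyRegular M xs) ∧
      ∀ xs : List R, xs.length = t → (∀ x ∈ xs, x ∈ I) →
        RingTheory.Sequence.IsWeaklyRegular M xs →
        Nonempty ((R ⧸ I →ₗ[R] PairDepth.cohomology I t M) ≃ₗ[R]
          (R ⧸ I →ₗ[R] M ⧸ (Ideal.ofList xs • ⊤ : Submodule R M))) := by
  have hle : PairDepth.pairDepth I J M ≤ PairDepth.depth I M :=
    iInf₂_le _ (PairDepth.self_mem_tildeW I J)
  -- Finiteness: `I` itself lies in `tildeW I J` and has finite depth since `IM ≠ M`.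
  obtain ⟨t, ht⟩ := ENat.ne_top_iff_exists.mp
    (ne_top_of_le_ne_top (PairDepth.depth_ne_top hM) hle)
  have htI : (t : ℕ∞) ≤ PairDepth.depth I M := ht.trans_le hle
  have hW : ∀ 𝔞 ∈ PairDepth.tildeW I J, (t : ℕ∞) ≤ PairDepth.depth 𝔞 M :=
    fun 𝔞 h𝔞 => ht.trans_le (iInf₂_le _ h𝔞)
  have hnt := PairDepth.nontrivial_cohomology_iff I J ht.le hM
  have hAss := fun 𝔭 h𝔭 => PairDepth.depth_eq_of_mem_associatedPrimes I J (𝔭 := 𝔭) ht.le h𝔭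
  obtain ⟨e⟩ := (PairDepth.cohomology_spec I J ht.le).1 I (PairDepth.self_mem_tildeW I ⊥)
  refine ⟨t, ht.symm, hnt, fun h 𝔞 h𝔞 => (hnt.mp h).trans_le (hW 𝔞 h𝔞), hAss,
    fun 𝔭 h𝔭 𝔞 h𝔞 => (hAss 𝔭 h𝔭).trans_le (hW 𝔞 h𝔞),
    (PairDepth.pairCohomology_spec I J ht.le).1 I (PairDepth.self_mem_tildeW I J), ⟨e.symm⟩,
    PairDepth.exists_isWeaklyRegular_of_natCast_le_depth hM htI, ?_⟩
  rintro xs rfl hxs hreg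
  obtain ⟨e'⟩ := PairDepth.nonempty_ext_length_equiv (N := R ⧸ I) xs
    (fun x hx => by rw [Ideal.annihilator_quotient]; exact hxs x hx) hreg fun i hi =>
      PairDepth.subsingleton_ext_of_lt_depth ((ENat.natCast_lt_natCast.mpr hi).trans_le htI)
  exact ⟨e.trans e'⟩
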